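/- Let $K$ be a field and $q\in K$ with $q\neq 1$ (for instance $K=\mathbb{Q}(q)$ with $q$ an indeterminate, or $q$ a real or complex number different from $1$). Put $[m]_q=\frac{1-q^m}{1-q}$, and let the $q$-tangent numbers $E_{2n+1}(q)$, $n\ge 0$, be defined by the formal power series expansion of the continued fraction $$\sum_{n=0}^{\infty} E_{2n+1}(q)\, x^n = \cfrac{1}{1-\cfrac{[1]_q[2]_q\,x}{1-\cfrac{[2]_q[3]_q\,x}{1-\cfrac{[3]_q[4]_q\,x}{\ddots}}}}\,,$$ where the continued fraction denotes the $x$-adic limit of its finite truncations. Then for every integer $n\ge 0$, $$E_{2n+1}(q)=\frac{1}{(1-q)^{2n+1}}\sum_{k=0}^{n}\left(\binom{2n+1}{n-k}-\binom{2n+1}{n-k-1}\right)\sum_{i=0}^{2k+1}(-1)^{i+k}q^{i(2k+2-i)},$$ where $\binom{m}{j}=0$ for $j<0$. -/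

import Mathlib

/-- The `q`-integer `[n]_q = (1 - q ^ n) / (1 - q)` (used for `q ≠ 1`). -/
def qInteger {K : Type*} [Field K] (q : K) (n : ℕ) : K :=
  (1 - q ^ n) / (1 - q)

/-- The finite continued fraction `1 / (1 - c₀ x / (1 - c₁ x / ( ⋯ / (1 - c_{N-1} x))))` with `N`
coefficients, as a formal power series in `x`. All denominators have constant coefficient `1`,
so that the inverse of power series is a true inverse. -/
noncomputable def stieltjesConvergent {K : Type*} [Field K] : (ℕ → K) → ℕ → PowerSeries K
  | _, 0 => 1
  | c, N + 1 =>
      (1 - PowerSeries.C (c 0) * PowerSeries.X * stieltjesConvergent (fun i => c (i + 1)) N)⁻¹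

/-- The infinite continued fraction `1 / (1 - c₀ x / (1 - c₁ x / (1 - c₂ x / ⋯)))` as a formal power
series in `x`, i.e. the `x`-adic limit of its convergents: the coefficient of `x ^ n` is the same in
all convergents with at least `n` coefficients (see `coeff_stieltjesConvergent`). -/
noncomputable def stieltjesFraction {K : Type*} [Field K] (c : ℕ → K) : PowerSeries K :=
  PowerSeries.mk fun n => PowerSeries.coeff n (stieltjesConvergent c n)

/-- Consecutive convergents agree up to the expected order. -/
theorem stieltjesConvergent_succ_sub {K : Type*} [Field K] (N : ℕ) (c : ℕ → K) :
    (PowerSeries.X : PowerSeries K) ^ (N + 1) ∣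
      stieltjesConvergent c (N + 1) - stieltjesConvergent c N := by
  induction N generalizing c with
  | zero =>
    rw [zero_add, pow_one, PowerSeries.X_dvd_iff]
    simp [stieltjesConvergent]
  | succ N ih =>
    obtain ⟨d, hd⟩ := ih (fun i => c (i + 1))
    rw [stieltjesConvergent.eq_2 c (N + 1), stieltjesConvergent.eq_2 c N]
    set A := stieltjesConvergent (fun i => c (i + 1)) (N + 1)
    set B := stieltjesConvergent (fun i => c (i + 1)) N
    have hA := PowerSeries.mul_inv_cancel
      (1 - PowerSeries.C (c 0) * PowerSeries.X * A) (by simp)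
    have hB := PowerSeries.mul_inv_cancel
      (1 - PowerSeries.C (c 0) * PowerSeries.X * B) (by simp)
    set a := (1 - PowerSeries.C (c 0) * PowerSeries.X * A)⁻¹
    set b := (1 - PowerSeries.C (c 0) * PowerSeries.X * B)⁻¹
    refine ⟨PowerSeries.C (c 0) * a * b * d, ?_⟩
    linear_combination
      PowerSeries.C (c 0) * PowerSeries.X * a * b * hd - a * hB + b * hA

/-- The coefficient of `x ^ n` in the infinite continued fraction is its coefficient in every
convergent with at least `n` coefficients. -/
theorem coeff_stieltjesConvergent {K : Type*} [Field K] (c : ℕ → K) {n N : ℕ} (h : n ≤ N) :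
    PowerSeries.coeff n (stieltjesConvergent c N) =
      PowerSeries.coeff n (stieltjesFraction c) := by
  rw [stieltjesFraction, PowerSeries.coeff_mk]
  induction N, h using Nat.le_induction with
  | base => rfl
  | succ N hN ih =>
    rw [← ih]
    have h1 := PowerSeries.X_pow_dvd_iff.mp (stieltjesConvergent_succ_sub N c) n (by omega)
    rw [map_sub] at h1
    exact sub_eq_zero.mp h1

/-- The `q`-tangent number `E_{2n+1}(q)`: the coefficient of `x ^ n` in the continued fraction
`1 / (1 - [1]_q [2]_q x / (1 - [2]_q [3]_q x / (1 - [3]_q [4]_q x / ⋯)))`. -/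
noncomputable def qTangentNumber {K : Type*} [Field K] (q : K) (n : ℕ) : K :=
  PowerSeries.coeff n (stieltjesFraction fun h => qInteger q (h + 1) * qInteger q (h + 2))

/-- The binomial coefficient with integer lower index, zero when that index is negative. -/
def binomInt (m : ℕ) (j : ℤ) : ℤ :=
  if 0 ≤ j then (m.choose j.toNat : ℤ) else 0

/-!
Let `Λ` be the linear functional on `K[X]` whose orthogonal polynomials obey
`Qₙ₊₁ = X Qₙ - (1 - q ^ n) (1 - q ^ (n + 1)) Qₙ₋₁`. Up to the factor `(1 - q) ^ (2 n)`, the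
`q`-tangent number is the moment `Λ (X ^ (2 n))`. The functional `L f = (1 - q) Λ (f / X)` on odd
polynomials is computed in three bases.

* On the continuous `q`-Hermite polynomials `H`, expanding in the `Qₙ` gives
  `L H₂ₖ₊₁ = (-1) ^ k (1 - q) (1 - q ^ 3) ⋯ (1 - q ^ (2 k + 1))`.
* In terms of Chebyshev polynomials (`Cₘ (s + s⁻¹) = s ^ m + s ^ (-m)`), `H₂ₖ₊₁` has the Gaussian
  binomials `[2 k + 1, k - d]` as coefficients. This triangular system determines `L C₂ₖ₊₁`, which
  turns out to be a difference of two consecutive alternating theta sums, by Gauss's evaluation of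
  `∑ j, (-1) ^ j [n, j]`.
* At `q = 1` the same expansion is that of `X ^ (2 n + 1)`, with ordinary binomials; applying `L` to
  it gives the formula after a summation by parts.
-/

open Finset Polynomial

section Sums

theorem sum_range_two_mul_add_two {M : Type*} [AddCommMonoid M] (f : ℕ → M) (k : ℕ) :
    ∑ j ∈ range (2 * k + 2), f j = ∑ d ∈ range (k + 1), (f (k - d) + f (k + 1 + d)) := by
  rw [show 2 * k + 2 = (k + 1) + (k + 1) by ring, sum_range_add, sum_add_distrib,
    ← sum_range_reflect f (k + 1)]
  simp only [Nat.add_sub_cancel]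

theorem eq_of_sum_range_mul_eq {R : Type*} [Ring R] {a : ℕ → ℕ → R} {u v : ℕ → R}
    (ha : ∀ k, a k k = 1)
    (h : ∀ k, ∑ d ∈ range (k + 1), a k d * u d = ∑ d ∈ range (k + 1), a k d * v d) (k : ℕ) :
    u k = v k := by
  induction k using Nat.strong_induction_on with
  | _ k ih =>
    have hlt : ∑ d ∈ range k, a k d * u d = ∑ d ∈ range k, a k d * v d :=
      sum_congr rfl fun d hd => by rw [ih d (mem_range.mp hd)]
    simpa only [sum_range_succ, hlt, ha, one_mul, add_right_inj] using h k

theorem binomInt_natCast_sub (m : ℕ) {n k : ℕ} (h : k ≤ n) :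
    binomInt m ((n : ℤ) - k) = m.choose (n - k) := by
  rw [← Nat.cast_sub h, binomInt, if_pos (Int.natCast_nonneg _), Int.toNat_natCast]

theorem sum_choose_mul_sub {R : Type*} [Ring R] (m n : ℕ) {t : ℕ → R} (ht : t 0 = 0) :
    ∑ d ∈ range (n + 1), (m.choose (n - d) : R) * (t (d + 1) - t d) =
      ∑ k ∈ range (n + 1),
        ((binomInt m ((n : ℤ) - k) - binomInt m ((n : ℤ) - k - 1) : ℤ) : R) * t (k + 1) := by
  let g : ℕ → R := fun k => (binomInt m ((n : ℤ) - k) : R) * t k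
  have hg : ∑ k ∈ range (n + 1), (g (k + 1) - g k) = 0 := by
    rw [sum_range_sub]
    simp [g, ht, binomInt]
  rw [← sub_eq_zero, ← hg, ← sum_sub_distrib]
  refine sum_congr rfl fun k hk => ?_
  simp only [g, Nat.cast_succ, ← sub_sub, binomInt_natCast_sub m (mem_range_succ_iff.mp hk),
    Int.cast_sub, Int.cast_natCast]
  noncomm_ring

end Sums

section GaussBinom

/-- The Gaussian binomial coefficient, defined by the `q`-Pascal rule so that it makes sense in any
commutative ring, including at roots of unity `q`. -/
def gaussBinom {R : Type*} [CommRing R] (q : R) : ℕ → ℕ → R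
  | _, 0 => 1
  | 0, _ + 1 => 0
  | n + 1, j + 1 => gaussBinom q n j + q ^ (j + 1) * gaussBinom q n (j + 1)

/-- The `q`-Pochhammer symbol `(q; q²)ₖ = (1 - q) (1 - q ^ 3) ⋯ (1 - q ^ (2 k - 1))`, the value of
several sums of Gaussian binomial coefficients. -/
def oddPochhammer {R : Type*} [CommRing R] (q : R) (k : ℕ) : R :=
  ∏ i ∈ range k, (1 - q ^ (2 * i + 1))

variable {R : Type*} [CommRing R] (q : R)

theorem gaussBinom_zero_right (n : ℕ) : gaussBinom q n 0 = 1 := by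
  cases n <;> rw [gaussBinom]

theorem gaussBinom_succ_succ (n j : ℕ) :
    gaussBinom q (n + 1) (j + 1) = gaussBinom q n j + q ^ (j + 1) * gaussBinom q n (j + 1) := by
  rw [gaussBinom]

theorem gaussBinom_eq_zero_of_lt {n j : ℕ} (h : n < j) : gaussBinom q n j = 0 := by
  induction n generalizing j with
  | zero =>
    obtain ⟨j, rfl⟩ := Nat.exists_eq_add_one.mpr h
    rw [gaussBinom]
  | succ n ih =>
    obtain ⟨j, rfl⟩ := Nat.exists_eq_add_one.mpr (Nat.zero_lt_of_lt h)
    rw [gaussBinom_succ_succ, ih (by lia), ih (by lia), mul_zero, add_zero]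

theorem gaussBinom_self (n : ℕ) : gaussBinom q n n = 1 := by
  induction n with
  | zero => exact gaussBinom_zero_right q 0
  | succ n ih =>
    rw [gaussBinom_succ_succ, ih, gaussBinom_eq_zero_of_lt q n.lt_succ_self, mul_zero, add_zero]

theorem gaussBinom_one (n j : ℕ) : gaussBinom (1 : R) n j = n.choose j := by
  induction n generalizing j with
  | zero => cases j <;> simp [gaussBinom]
  | succ n ih =>
    cases j with
    | zero => simp [gaussBinom_zero_right]
    | succ j => simp [gaussBinom_succ_succ, ih, Nat.choose_succ_succ]

theorem one_sub_pow_mul_gaussBinom_succ_succ (n j : ℕ) :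
    (1 - q ^ (j + 1)) * gaussBinom q (n + 1) (j + 1) = (1 - q ^ (n + 1)) * gaussBinom q n j := by
  induction n generalizing j with
  | zero =>
    cases j with
    | zero => simp [gaussBinom]
    | succ j => simp [gaussBinom_eq_zero_of_lt]
  | succ n ih =>
    cases j with
    | zero =>
      have h := ih 0
      rw [gaussBinom_succ_succ]
      simp only [gaussBinom_zero_right] at h ⊢
      linear_combination q * h
    | succ j =>
      rw [gaussBinom_succ_succ q (n + 1)]
      linear_combination q ^ (j + 2) * ih (j + 1) + q * ih j -
        q * (1 - q ^ (n + 1)) * gaussBinom_succ_succ q n j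

theorem gaussBinom_succ_succ' {n j : ℕ} (h : j ≤ n) :
    gaussBinom q (n + 1) (j + 1) = q ^ (n - j) * gaussBinom q n j + gaussBinom q n (j + 1) := by
  induction n generalizing j with
  | zero => simp [Nat.le_zero.mp h, gaussBinom]
  | succ n ih =>
    obtain rfl | hlt := h.eq_or_lt
    · simp [gaussBinom_self, gaussBinom_eq_zero_of_lt]
    obtain ⟨d, rfl⟩ := Nat.exists_eq_add_of_le (Nat.lt_succ_iff.mp hlt)
    have ih_right := ih (j := j) (by lia)
    cases j with
    | zero =>
      simp only [zero_add, gaussBinom_zero_right, Nat.sub_zero, gaussBinom_succ_succ]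
        at ih_right ⊢
      linear_combination q * ih_right
    | succ j =>
      have ih_left := ih (j := j) (by lia)
      rw [gaussBinom_succ_succ q (j + 1 + d + 1) (j + 1)]
      rw [show j + 1 + d - j = d + 1 by lia] at ih_left
      rw [show j + 1 + d - (j + 1) = d by lia] at ih_right
      rw [show j + 1 + d + 1 - (j + 1) = d + 1 by lia]
      linear_combination ih_left + q ^ (j + 2) * ih_right -
        q ^ (d + 1) * gaussBinom_succ_succ q (j + 1 + d) j -
        gaussBinom_succ_succ q (j + 1 + d) (j + 1)

theorem gaussBinom_symm {n j : ℕ} (h : j ≤ n) : gaussBinom q n (n - j) = gaussBinom q n j := by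
  induction n generalizing j with
  | zero => rw [Nat.le_zero.mp h]
  | succ n ih =>
    cases j with
    | zero => rw [Nat.sub_zero, gaussBinom_self, gaussBinom_zero_right]
    | succ j =>
      rw [Nat.add_sub_add_right]
      obtain rfl | hlt := (Nat.succ_le_succ_iff.mp h).eq_or_lt
      · rw [Nat.sub_self, gaussBinom_self, gaussBinom_zero_right]
      · rw [gaussBinom_succ_succ' q hlt.le, ← ih hlt.le, ← ih hlt,
          show n - j = n - (j + 1) + 1 by lia, gaussBinom_succ_succ, add_comm]

theorem one_sub_pow_mul_gaussBinom_succ_right {n j : ℕ} (h : j ≤ n) :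
    (1 - q ^ (j + 1)) * gaussBinom q n (j + 1) = (1 - q ^ (n - j)) * gaussBinom q n j := by
  have hpow : q ^ (n - j) * q ^ (j + 1) = q ^ (n + 1) := by
    rw [← pow_add, show n - j + (j + 1) = n + 1 by lia]
  linear_combination one_sub_pow_mul_gaussBinom_succ_succ q n j -
    (1 - q ^ (j + 1)) * gaussBinom_succ_succ' q h + gaussBinom q n j * hpow

theorem oddPochhammer_succ (k : ℕ) :
    oddPochhammer q (k + 1) = oddPochhammer q k * (1 - q ^ (2 * k + 1)) :=
  prod_range_succ _ _

end GaussBinom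

section RogersSzego

/-- The Rogers–Szegő polynomial, the generating polynomial of a row of Gaussian binomial
coefficients. -/
noncomputable def rogersSzego {R : Type*} [CommRing R] (q : R) (n : ℕ) : R[X] :=
  ∑ j ∈ range (n + 1), C (gaussBinom q n j) * X ^ j

variable {R : Type*} [CommRing R] (q : R)

theorem coeff_rogersSzego (n j : ℕ) : (rogersSzego q n).coeff j = gaussBinom q n j := by
  simp only [rogersSzego, finsetSum_coeff, coeff_C_mul_X_pow, sum_ite_eq, mem_range,
    ite_eq_left_iff, Nat.not_lt, Nat.succ_le_iff]
  exact fun h => (gaussBinom_eq_zero_of_lt q h).symm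

theorem rogersSzego_succ_succ (n : ℕ) :
    rogersSzego q (n + 2) =
      (1 + X) * rogersSzego q (n + 1) - C (1 - q ^ (n + 1)) * (X * rogersSzego q n) := by
  ext j
  cases j with
  | zero => simp [add_mul, coeff_rogersSzego, gaussBinom_zero_right]
  | succ j =>
    simp only [add_mul, one_mul, coeff_sub, coeff_add, coeff_C_mul, coeff_X_mul,
      coeff_rogersSzego]
    linear_combination gaussBinom_succ_succ q (n + 1) j -
      one_sub_pow_mul_gaussBinom_succ_succ q n j

theorem rogersSzego_comp_C_mul_X (n : ℕ) :
    (rogersSzego q n).comp (C q * X) = rogersSzego q (n + 1) - X * rogersSzego q n := by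
  ext j
  rw [comp_C_mul_X_coeff, coeff_sub]
  cases j with
  | zero => simp [coeff_rogersSzego, gaussBinom_zero_right]
  | succ j =>
    simp only [coeff_X_mul, coeff_rogersSzego, gaussBinom_succ_succ]
    ring

theorem eval_neg_one_rogersSzego_two_mul (k : ℕ) :
    (rogersSzego q (2 * k)).eval (-1) = oddPochhammer q k := by
  induction k with
  | zero => simp [rogersSzego, oddPochhammer, gaussBinom_zero_right]
  | succ k ih =>
    rw [Nat.mul_succ, rogersSzego_succ_succ, oddPochhammer_succ]
    simp only [eval_sub, eval_mul, eval_add, eval_one, eval_X, eval_C, ih]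
    ring

theorem eval_neg_one_rogersSzego_two_mul_add_one (k : ℕ) :
    (rogersSzego q (2 * k + 1)).eval (-1) = 0 := by
  induction k with
  | zero => simp [rogersSzego, gaussBinom_self, sum_range_succ, gaussBinom_zero_right]
  | succ k ih =>
    rw [Nat.mul_succ, add_right_comm, rogersSzego_succ_succ]
    simp [ih]

theorem eval_neg_rogersSzego_two_mul_add_one (k : ℕ) :
    (rogersSzego q (2 * k + 1)).eval (-q) = oddPochhammer q (k + 1) := by
  have h := congrArg (eval (-1)) (rogersSzego_comp_C_mul_X q (2 * k + 1))
  rw [eval_sub, eval_mul, eval_neg_one_rogersSzego_two_mul_add_one, mul_zero, sub_zero] at h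
  rw [← eval_neg_one_rogersSzego_two_mul, Nat.mul_succ, ← h]
  simp [eval_comp]

end RogersSzego

section AlternatingTheta

/-- The alternating theta sum `∑ (-1) ^ (i + m + 1) q ^ (i (2 m - i))` over `0 ≤ i < 2 m`; the
inner sum of the formula for `E_{2n+1}(q)` is the one for `m = k + 1`. -/
def alternatingTheta {R : Type*} [CommRing R] (q : R) (m : ℕ) : R :=
  ∑ i ∈ range (2 * m), (-1) ^ (i + m + 1) * q ^ (i * (2 * m - i))

variable {R : Type*} [CommRing R] (q : R)

theorem alternatingTheta_zero : alternatingTheta q 0 = 0 := sum_range_zero _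

theorem alternatingTheta_succ_eq_sum (k : ℕ) :
    alternatingTheta q (k + 1) =
      ∑ i ∈ range (2 * k + 2), (-1) ^ (i + k) * q ^ (i * (2 * k + 2 - i)) :=
  sum_congr rfl fun i _ => by
    rw [show i + (k + 1) + 1 = i + k + 2 by ring, pow_add _ (i + k), neg_one_sq, mul_one,
      Nat.mul_succ]

theorem alternatingTheta_succ (m : ℕ) :
    alternatingTheta q (m + 1) =
      q ^ (2 * m + 1) * alternatingTheta q m + (-1) ^ m * (1 - q ^ (2 * m + 1)) := by
  have interior : ∑ i ∈ range (2 * m), (-1 : R) ^ (i + 1 + m) *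
        q ^ ((i + 1) * (2 * m + 2 - (i + 1))) = q ^ (2 * m + 1) * alternatingTheta q m := by
    rw [alternatingTheta, mul_sum]
    refine sum_congr rfl fun i hi => ?_
    obtain ⟨d, hd⟩ := Nat.exists_eq_add_of_lt (mem_range.mp hi)
    rw [show 2 * m + 2 - (i + 1) = d + 2 by lia, show 2 * m - i = d + 1 by lia, hd]
    ring
  have sign : (-1 : R) ^ (2 * m) = 1 := (even_two_mul m).neg_one_pow
  rw [alternatingTheta_succ_eq_sum, sum_range_succ, sum_range_succ', interior,
    show 2 * m + 2 - (2 * m + 1) = 1 by lia]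
  linear_combination -(q ^ (2 * m + 1) * (-1) ^ m) * sign

theorem sum_neg_one_pow_mul_gaussBinom (k : ℕ) :
    ∑ d ∈ range (k + 1),
        (-1) ^ d * gaussBinom q (2 * k + 1) (k - d) * (q ^ (k - d) - q ^ (k + 1 + d)) =
      (-1) ^ k * oddPochhammer q (k + 1) := by
  rw [← eval_neg_rogersSzego_two_mul_add_one, rogersSzego, eval_finsetSum,
    sum_range_two_mul_add_two, mul_sum]
  refine sum_congr rfl fun d hd => ?_
  obtain ⟨j, rfl⟩ := Nat.exists_eq_add_of_le' (mem_range_succ_iff.mp hd)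
  have symm := gaussBinom_symm q (n := 2 * (j + d) + 1) (j := j) (by lia)
  rw [show 2 * (j + d) + 1 - j = j + d + 1 + d by lia] at symm
  have sign (i : ℕ) : (-1 : R) ^ (2 * i) = 1 := (even_two_mul i).neg_one_pow
  rw [Nat.add_sub_cancel]
  simp only [eval_mul, eval_C, eval_pow, eval_X, symm, neg_pow q]
  have hj : (-1 : R) ^ (j + d) * (-1) ^ j = (-1) ^ d := by
    linear_combination (-1) ^ d * sign j
  have hd : (-1 : R) ^ (j + d) * (-1) ^ (j + d + 1 + d) = -(-1) ^ d := by
    linear_combination -(-1) ^ d * sign (j + d)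
  linear_combination -gaussBinom q (2 * (j + d) + 1) j * (q ^ j * hj + q ^ (j + d + 1 + d) * hd)

theorem sum_gaussBinom_mul_sub_eq_zero {t : ℕ → R} (ht : t 0 = 0) (k : ℕ) :
    ∑ d ∈ range (k + 1), gaussBinom q (2 * k + 1) (k - d) *
        ((1 - q ^ (k - d)) * t (d + 1) - (1 - q ^ (k + 1 + d)) * t d) = 0 := by
  let f : ℕ → R := fun d =>
    gaussBinom q (2 * k + 1) (k + 1 - d) * (1 - q ^ (k + 1 - d)) * t d
  have hf : ∑ d ∈ range (k + 1), (f (d + 1) - f d) = 0 := by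
    rw [sum_range_sub]
    simp [f, ht]
  rw [← hf]
  refine sum_congr rfl fun d hd => ?_
  obtain ⟨j, rfl⟩ := Nat.exists_eq_add_of_le' (mem_range_succ_iff.mp hd)
  have absorb := one_sub_pow_mul_gaussBinom_succ_right q
    (n := 2 * (j + d) + 1) (j := j) (by lia)
  rw [show 2 * (j + d) + 1 - j = j + d + 1 + d by lia] at absorb
  simp only [f]
  rw [show j + d + 1 - (d + 1) = j by lia, show j + d + 1 - d = j + 1 by lia, Nat.add_sub_cancel]
  linear_combination t d * absorb

theorem sum_gaussBinom_mul_alternatingTheta_sub (k : ℕ) :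
    ∑ d ∈ range (k + 1), gaussBinom q (2 * k + 1) (k - d) *
        (alternatingTheta q (d + 1) - alternatingTheta q d) =
      (-1) ^ k * oddPochhammer q (k + 1) := by
  rw [← sum_neg_one_pow_mul_gaussBinom, ← sub_eq_zero, ← sum_sub_distrib,
    ← sum_gaussBinom_mul_sub_eq_zero q (alternatingTheta_zero q) k]
  refine sum_congr rfl fun d hd => ?_
  obtain ⟨j, rfl⟩ := Nat.exists_eq_add_of_le' (mem_range_succ_iff.mp hd)
  rw [Nat.add_sub_cancel]
  linear_combination gaussBinom q (2 * (j + d) + 1) j * q ^ j * alternatingTheta_succ q d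

end AlternatingTheta

section QHermite

/-- The continuous `q`-Hermite polynomials, normalized to be monic in `X = s + s⁻¹`. -/
noncomputable def qHermite {R : Type*} [CommRing R] (q : R) : ℕ → R[X]
  | 0 => 1
  | 1 => X
  | n + 2 => X * qHermite q (n + 1) - C (1 - q ^ (n + 1)) * qHermite q n

/-- The linear map `X ^ j ↦ S_{m - 2 j}` into the Chebyshev polynomials of the second kind, with
`S_m (s + s⁻¹) = (s ^ (m + 1) - s ^ (-m - 1)) / (s - s⁻¹)`. It carries the Rogers–Szegő polynomials
to the `q`-Hermite polynomials. -/
noncomputable def chebyshevTransform (R : Type*) [CommRing R] (m : ℤ) : R[X] →ₗ[R] R[X] :=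
  lsum fun j => LinearMap.toSpanSingleton R R[X] (Chebyshev.S R (m - 2 * j))

variable {R : Type*} [CommRing R] (q : R)

theorem chebyshevTransform_C_mul_X_pow (m : ℤ) (a : R) (j : ℕ) :
    chebyshevTransform R m (C a * X ^ j) = C a * Chebyshev.S R (m - 2 * j) := by
  rw [chebyshevTransform, C_mul_X_pow_eq_monomial, lsum_apply,
    sum_monomial_index _ _ (LinearMap.map_zero _), LinearMap.toSpanSingleton_apply, smul_eq_C_mul]

theorem chebyshevTransform_one (m : ℤ) : chebyshevTransform R m 1 = Chebyshev.S R m := by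
  simpa using chebyshevTransform_C_mul_X_pow m (1 : R) 0

theorem chebyshevTransform_X_mul (m : ℤ) (p : R[X]) :
    chebyshevTransform R (m + 2) (X * p) = chebyshevTransform R m p := by
  induction p using Polynomial.induction_on' with
  | add p p' hp hp' => rw [mul_add, map_add, map_add, hp, hp']
  | monomial j a =>
    rw [← C_mul_X_pow_eq_monomial, mul_left_comm, ← pow_succ', chebyshevTransform_C_mul_X_pow,
      chebyshevTransform_C_mul_X_pow]
    congr 2
    push_cast
    ring

theorem chebyshevTransform_one_add_X_mul (m : ℤ) (p : R[X]) :
    chebyshevTransform R (m + 1) ((1 + X) * p) = X * chebyshevTransform R m p := by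
  induction p using Polynomial.induction_on' with
  | add p p' hp hp' => rw [mul_add, map_add, map_add, hp, hp', mul_add]
  | monomial j a =>
    have h := Chebyshev.S_add_one R (m - 2 * j)
    rw [show m - 2 * j - 1 = m + 1 - 2 * (j + 1 : ℕ) by push_cast; ring,
      sub_add_eq_add_sub] at h
    rw [← C_mul_X_pow_eq_monomial, add_mul, one_mul, mul_left_comm, ← pow_succ', map_add,
      chebyshevTransform_C_mul_X_pow, chebyshevTransform_C_mul_X_pow,
      chebyshevTransform_C_mul_X_pow, h]
    ring

theorem qHermite_eq_chebyshevTransform (n : ℕ) :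
    qHermite q n = chebyshevTransform R n (rogersSzego q n) := by
  induction n using Nat.twoStepInduction with
  | zero => simp [qHermite, rogersSzego, gaussBinom, chebyshevTransform_one]
  | one =>
    have h := chebyshevTransform_one_add_X_mul (R := R) 0 1
    simpa [qHermite, rogersSzego, sum_range_succ, gaussBinom, chebyshevTransform_one,
      eq_comm] using h
  | more n ih ih' =>
    have cast : ((n + 1 : ℕ) : ℤ) + 1 = (n + 2 : ℕ) := by push_cast; ring
    rw [qHermite, rogersSzego_succ_succ, ih, ih', ← smul_eq_C_mul, ← smul_eq_C_mul,
      LinearMap.map_sub, LinearMap.map_smul, ← chebyshevTransform_one_add_X_mul, cast,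
      ← chebyshevTransform_X_mul (n : ℤ) (rogersSzego q n), Nat.cast_add n 2, Nat.cast_ofNat]

theorem qHermite_one (n : ℕ) : qHermite (1 : R) n = X ^ n := by
  induction n using Nat.twoStepInduction with
  | zero => rw [qHermite, pow_zero]
  | one => rw [qHermite, pow_one]
  | more n _ ih => rw [qHermite, ih, one_pow, sub_self, C_0, zero_mul, sub_zero, ← pow_succ']

theorem chebyshevS_sub_chebyshevS_sub_two (m : ℤ) :
    Chebyshev.S R m - Chebyshev.S R (m - 2) = Chebyshev.C R m := by
  rw [Chebyshev.C_eq_S_sub_X_mul_S, Chebyshev.S_sub_two]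
  ring

theorem qHermite_two_mul_add_one_eq_sum (k : ℕ) :
    qHermite q (2 * k + 1) =
      ∑ d ∈ range (k + 1),
        C (gaussBinom q (2 * k + 1) (k - d)) * Chebyshev.C R (2 * d + 1) := by
  rw [qHermite_eq_chebyshevTransform, rogersSzego, map_sum, sum_range_two_mul_add_two]
  refine sum_congr rfl fun d hd => ?_
  obtain ⟨j, rfl⟩ := Nat.exists_eq_add_of_le' (mem_range_succ_iff.mp hd)
  have symm := gaussBinom_symm q (n := 2 * (j + d) + 1) (j := j) (by lia)
  rw [show 2 * (j + d) + 1 - j = j + d + 1 + d by lia] at symm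
  have left : ((2 * (j + d) + 1 : ℕ) : ℤ) - 2 * j = 2 * d + 1 := by push_cast; ring
  have right : ((2 * (j + d) + 1 : ℕ) : ℤ) - 2 * (j + d + 1 + d : ℕ) = -(2 * d + 1) := by
    push_cast; ring
  rw [Nat.add_sub_cancel, chebyshevTransform_C_mul_X_pow, chebyshevTransform_C_mul_X_pow, symm,
    left, right, Chebyshev.S_neg, ← mul_add, ← sub_eq_add_neg, chebyshevS_sub_chebyshevS_sub_two]

end QHermite

section JacobiCoord

/-- The Jacobi operator `v ↦ (h ↦ v (h - 1) + c h * v (h + 1))` on sequences, with ones below the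
diagonal. In the basis of monic polynomials `Q` with `X Qₕ = Qₕ₊₁ + c (h - 1) Qₕ₋₁` it is
multiplication by `X`. -/
def jacobiOperator {R : Type*} [CommRing R] (c : ℕ → R) : Module.End R (ℕ → R) where
  toFun v
    | 0 => c 0 * v 1
    | h + 1 => v h + c (h + 1) * v (h + 2)
  map_add' v w := by
    funext h
    cases h <;> simp only [Pi.add_apply] <;> ring
  map_smul' a v := by
    funext h
    cases h <;> simp only [Pi.smul_apply, smul_eq_mul, RingHom.id_apply] <;> ring

/-- The coordinates of a polynomial in the basis of monic polynomials `Q` with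
`X Qₕ = Qₕ₊₁ + c (h - 1) Qₕ₋₁`, obtained by applying the polynomial in the Jacobi operator to the
first basis vector. The coordinate at `0` is the functional for which the `Qₕ` are orthogonal. -/
noncomputable def jacobiCoord {R : Type*} [CommRing R] (c : ℕ → R) : R[X] →ₗ[R] ℕ → R :=
  LinearMap.applyₗ (Pi.single 0 1) ∘ₗ (aeval (jacobiOperator c)).toLinearMap

variable {R : Type*} [CommRing R] (c : ℕ → R)

theorem jacobiCoord_one : jacobiCoord c 1 = Pi.single 0 1 := by
  simp [jacobiCoord]

theorem jacobiCoord_C_mul (a : R) (f : R[X]) (h : ℕ) :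
    jacobiCoord c (C a * f) h = a * jacobiCoord c f h := by
  rw [← smul_eq_C_mul, map_smul, Pi.smul_apply, smul_eq_mul]

theorem jacobiCoord_X_mul (f : R[X]) :
    jacobiCoord c (X * f) = jacobiOperator c (jacobiCoord c f) := by
  simp [jacobiCoord]

theorem jacobiCoord_X_mul_zero (f : R[X]) :
    jacobiCoord c (X * f) 0 = c 0 * jacobiCoord c f 1 := by
  rw [jacobiCoord_X_mul]; rfl

theorem jacobiCoord_X_mul_succ (f : R[X]) (h : ℕ) :
    jacobiCoord c (X * f) (h + 1) =
      jacobiCoord c f h + c (h + 1) * jacobiCoord c f (h + 2) := by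
  rw [jacobiCoord_X_mul]; rfl

theorem jacobiCoord_qHermite_succ_succ (q : R) (n h : ℕ) :
    jacobiCoord c (qHermite q (n + 2)) h =
      jacobiCoord c (X * qHermite q (n + 1)) h -
        (1 - q ^ (n + 1)) * jacobiCoord c (qHermite q n) h := by
  rw [qHermite, map_sub, Pi.sub_apply, jacobiCoord_C_mul]

theorem jacobiCoord_qHermite_of_lt (q : R) {n h : ℕ} (hn : n < h) :
    jacobiCoord c (qHermite q n) h = 0 := by
  induction n using Nat.twoStepInduction generalizing h with
  | zero => simp [qHermite, jacobiCoord_one, hn.ne']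
  | one =>
    obtain ⟨h, rfl⟩ := Nat.exists_eq_add_of_le' hn
    simpa [qHermite, jacobiCoord_one] using jacobiCoord_X_mul_succ c 1 (h + 1)
  | more n ih ih' =>
    obtain ⟨h, rfl⟩ := Nat.exists_eq_add_one.mpr (Nat.zero_lt_of_lt hn)
    rw [jacobiCoord_qHermite_succ_succ, jacobiCoord_X_mul_succ,
      ih (by lia), ih' (by lia), ih' (by lia)]
    ring

theorem jacobiCoord_X_pow_of_lt {n h : ℕ} (hn : n < h) : jacobiCoord c (X ^ n) h = 0 := by
  rw [← qHermite_one, jacobiCoord_qHermite_of_lt c 1 hn]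

theorem jacobiCoord_qHermite_self (q : R) (n : ℕ) : jacobiCoord c (qHermite q n) n = 1 := by
  induction n using Nat.twoStepInduction with
  | zero => simp [qHermite, jacobiCoord_one]
  | one => simpa [qHermite, jacobiCoord_one] using jacobiCoord_X_mul_succ c 1 0
  | more n _ ih =>
    rw [jacobiCoord_qHermite_succ_succ, jacobiCoord_X_mul_succ, ih,
      jacobiCoord_qHermite_of_lt c q (by lia), jacobiCoord_qHermite_of_lt c q (by lia)]
    ring

end JacobiCoord

section StieltjesFraction

/-- The formal power series in `x` satisfying the three-term recurrence of the continued fraction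
with coefficients `c`; the entry at `h + 1` collects the coordinates at `h` of `X ^ (2 n + h)`. -/
noncomputable def jacobiSeries {R : Type*} [CommRing R] (c : ℕ → R) : ℕ → PowerSeries R
  | 0 => 1
  | h + 1 => PowerSeries.mk fun n => jacobiCoord c (X ^ (2 * n + h)) h

theorem jacobiSeries_succ {R : Type*} [CommRing R] (c : ℕ → R) (h : ℕ) :
    jacobiSeries c (h + 1) =
      jacobiSeries c h + PowerSeries.C (c h) * PowerSeries.X * jacobiSeries c (h + 2) := by
  ext n
  rw [map_add, mul_assoc, PowerSeries.coeff_C_mul]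
  cases n with
  | zero =>
    rw [PowerSeries.coeff_zero_X_mul, mul_zero, add_zero]
    cases h with
    | zero => simp [jacobiSeries, jacobiCoord_one]
    | succ h =>
      simp only [jacobiSeries, PowerSeries.coeff_mk, mul_zero, zero_add]
      rw [pow_succ', jacobiCoord_X_mul_succ,
        jacobiCoord_X_pow_of_lt c (show h < h + 2 by lia), mul_zero, add_zero]
  | succ n =>
    rw [PowerSeries.coeff_succ_X_mul]
    cases h with
    | zero =>
      simp only [jacobiSeries, PowerSeries.coeff_mk, PowerSeries.coeff_one, Nat.succ_ne_zero,
        if_false, zero_add, add_zero]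
      rw [show 2 * (n + 1) = 2 * n + 1 + 1 by ring, pow_succ', jacobiCoord_X_mul_zero]
    | succ h =>
      simp only [jacobiSeries, PowerSeries.coeff_mk]
      rw [← add_assoc, pow_succ', jacobiCoord_X_mul_succ,
        show 2 * (n + 1) + h = 2 * n + (h + 1 + 1) by ring]

variable {K : Type*} [Field K]

theorem stieltjesConvergent_succ_mul (c : ℕ → K) (N : ℕ) :
    (1 - PowerSeries.C (c 0) * PowerSeries.X * stieltjesConvergent (fun i => c (i + 1)) N) *
      stieltjesConvergent c (N + 1) = 1 := by
  rw [stieltjesConvergent, PowerSeries.mul_inv_cancel _ (by simp)]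

theorem X_pow_dvd_sub_mul_stieltjesConvergent {c : ℕ → K} {G : ℕ → PowerSeries K}
    (hG : ∀ h, G (h + 1) = G h + PowerSeries.C (c h) * PowerSeries.X * G (h + 2)) (N : ℕ) :
    (PowerSeries.X : PowerSeries K) ^ (N + 1) ∣ G 1 - G 0 * stieltjesConvergent c N := by
  induction N generalizing c G with
  | zero =>
    refine ⟨PowerSeries.C (c 0) * G 2, ?_⟩
    rw [stieltjesConvergent, hG 0]
    ring
  | succ N ih =>
    obtain ⟨d, hd⟩ := ih (c := fun i => c (i + 1)) (G := fun i => G (i + 1)) fun h => hG (h + 1)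
    refine ⟨PowerSeries.C (c 0) * stieltjesConvergent c (N + 1) * d, ?_⟩
    linear_combination
      PowerSeries.C (c 0) * PowerSeries.X * stieltjesConvergent c (N + 1) * hd -
        G 1 * stieltjesConvergent_succ_mul c N + stieltjesConvergent c (N + 1) * hG 0

theorem coeff_stieltjesFraction (c : ℕ → K) (n : ℕ) :
    PowerSeries.coeff n (stieltjesFraction c) = jacobiCoord c (X ^ (2 * n)) 0 := by
  have h := PowerSeries.X_pow_dvd_iff.mp
    (X_pow_dvd_sub_mul_stieltjesConvergent (jacobiSeries_succ c) n) n n.lt_succ_self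
  rw [map_sub, jacobiSeries, one_mul, coeff_stieltjesConvergent c le_rfl, sub_eq_zero,
    jacobiSeries, PowerSeries.coeff_mk] at h
  exact h.symm

theorem stieltjesConvergent_const_mul (r : K) (c : ℕ → K) (N : ℕ) :
    stieltjesConvergent (fun h => r * c h) N =
      PowerSeries.rescale r (stieltjesConvergent c N) := by
  induction N generalizing c with
  | zero => rw [stieltjesConvergent, stieltjesConvergent, map_one]
  | succ N ih =>
    have h := congrArg (PowerSeries.rescale r) (stieltjesConvergent_succ_mul c N)
    have hC (a : K) : PowerSeries.rescale r (PowerSeries.C a) = PowerSeries.C a := by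
      ext n
      cases n <;> simp [PowerSeries.coeff_C]
    simp only [map_mul, map_sub, map_one, hC, PowerSeries.rescale_X] at h
    rw [stieltjesConvergent, PowerSeries.inv_eq_iff_mul_eq_one (by simp), ih, map_mul]
    linear_combination h

theorem coeff_stieltjesFraction_const_mul (r : K) (c : ℕ → K) (n : ℕ) :
    PowerSeries.coeff n (stieltjesFraction fun h => r * c h) =
      r ^ n * PowerSeries.coeff n (stieltjesFraction c) := by
  rw [← coeff_stieltjesConvergent _ le_rfl, ← coeff_stieltjesConvergent _ le_rfl,
    stieltjesConvergent_const_mul, PowerSeries.coeff_rescale]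

/-- The coefficients of the continued fraction of the `q`-tangent numbers, cleared of the
denominator `(1 - q) ^ 2`. -/
def tangentWeight {R : Type*} [CommRing R] (q : R) (h : ℕ) : R :=
  (1 - q ^ (h + 1)) * (1 - q ^ (h + 2))

theorem qTangentNumber_eq (q : K) (n : ℕ) :
    qTangentNumber q n =
      (1 / (1 - q) ^ 2) ^ n * jacobiCoord (tangentWeight q) (X ^ (2 * n)) 0 := by
  rw [← coeff_stieltjesFraction, ← coeff_stieltjesFraction_const_mul, qTangentNumber]
  congr 2
  funext h
  rw [qInteger, qInteger, tangentWeight, div_mul_div_comm, ← sq, one_div, div_eq_inv_mul]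

end StieltjesFraction

section Moments

/-- The functional `f ↦ (1 - q) Λ (f / X)`, where `Λ` is the moment functional with recurrence
coefficients `tangentWeight q`. It is meant for odd `f`; `divX` discards a constant term. -/
noncomputable def oddMoment {R : Type*} [CommRing R] (q : R) : R[X] →ₗ[R] R where
  toFun f := (1 - q) * jacobiCoord (tangentWeight q) f.divX 0
  map_add' f g := by rw [divX_add, map_add, Pi.add_apply, mul_add]
  map_smul' a f := by
    rw [smul_eq_C_mul, divX_C_mul, ← smul_eq_C_mul, map_smul, Pi.smul_apply, mul_smul_comm,
      RingHom.id_apply]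

variable {R : Type*} [CommRing R] (q : R)

-- The recurrence of the `q`-Hermite polynomials, read off on the coordinate of index `i` under the
-- closed form found in `jacobiCoord_tangentWeight_qHermite`.
theorem gaussBinom_mul_oddPochhammer_rec (i j : ℕ) :
    (-1) ^ (j + 1) * q ^ (2 * (j + 1)) * gaussBinom q (i + 2 * (j + 1)) (2 * (j + 1)) *
        oddPochhammer q (j + 1) =
      (-1) ^ (j + 1) * q ^ (2 * (j + 1)) * gaussBinom q (i + 2 * j + 1) (2 * (j + 1)) *
          oddPochhammer q (j + 1) +
        tangentWeight q i *
          ((-1) ^ j * q ^ (2 * j) * gaussBinom q (i + 1 + 2 * j) (2 * j) * oddPochhammer q j) -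
        (1 - q ^ (i + 2 * j + 1)) *
          ((-1) ^ j * q ^ (2 * j) * gaussBinom q (i + 2 * j) (2 * j) * oddPochhammer q j) := by
  have absorb := one_sub_pow_mul_gaussBinom_succ_succ q (i + 2 * j) (2 * j)
  have step := one_sub_pow_mul_gaussBinom_succ_right q
    (n := i + 2 * j + 1) (j := 2 * j) (by lia)
  have pascal := gaussBinom_succ_succ' q (n := i + 2 * j + 1) (j := 2 * j + 1) (by lia)
  rw [show i + 2 * j + 1 - 2 * j = i + 1 by lia] at step
  rw [show i + 2 * j + 1 - (2 * j + 1) = i by lia] at pascal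
  rw [oddPochhammer_succ, show 2 * (j + 1) = 2 * j + 1 + 1 by ring,
    show i + (2 * j + 1 + 1) = i + 2 * j + 1 + 1 by ring, pascal,
    show i + 1 + 2 * j = i + 2 * j + 1 by ring, tangentWeight]
  linear_combination (-1) ^ j * q ^ (2 * j) * oddPochhammer q j *
    ((1 - q ^ (i + 2)) * step - absorb)

theorem jacobiCoord_tangentWeight_qHermite (h j : ℕ) :
    jacobiCoord (tangentWeight q) (qHermite q (h + 2 * j)) h =
      (-1) ^ j * q ^ (2 * j) * gaussBinom q (h + 2 * j) (2 * j) * oddPochhammer q j := by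
  induction j generalizing h with
  | zero => simp [jacobiCoord_qHermite_self, gaussBinom_zero_right, oddPochhammer]
  | succ j ihj =>
    induction h with
    | zero =>
      have step := jacobiCoord_qHermite_succ_succ (tangentWeight q) q (0 + 2 * j) 0
      rw [jacobiCoord_X_mul_zero] at step
      rw [gaussBinom_mul_oddPochhammer_rec, ← ihj 0, ← ihj (0 + 1),
        gaussBinom_eq_zero_of_lt q (show 0 + 2 * j + 1 < 2 * (j + 1) by lia),
        show 0 + 1 + 2 * j = 0 + 2 * j + 1 by ring]
      linear_combination step
    | succ h ihh =>
      have step := jacobiCoord_qHermite_succ_succ (tangentWeight q) q (h + 1 + 2 * j) (h + 1)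
      rw [jacobiCoord_X_mul_succ] at step
      rw [show h + 2 * (j + 1) = h + 1 + 2 * j + 1 by ring] at ihh
      rw [gaussBinom_mul_oddPochhammer_rec, ← ihj (h + 1), ← ihj (h + 1 + 1), ← ihh,
        show h + 1 + 1 + 2 * j = h + 1 + 2 * j + 1 by ring]
      linear_combination step

theorem oddMoment_X_mul (f : R[X]) :
    oddMoment q (X * f) = (1 - q) * jacobiCoord (tangentWeight q) f 0 := by
  have h : (X * f).divX = f := by ext; rw [coeff_divX, coeff_X_mul]
  rw [oddMoment, LinearMap.coe_mk, AddHom.coe_mk, h]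

theorem oddMoment_C_mul (a : R) (f : R[X]) : oddMoment q (C a * f) = a * oddMoment q f := by
  rw [← smul_eq_C_mul, map_smul, smul_eq_mul]

theorem oddMoment_qHermite (k : ℕ) :
    oddMoment q (qHermite q (2 * k + 1)) = (-1) ^ k * oddPochhammer q (k + 1) := by
  induction k with
  | zero => simpa [qHermite, oddPochhammer, jacobiCoord_one] using oddMoment_X_mul q 1
  | succ k ih =>
    have coord := jacobiCoord_tangentWeight_qHermite q 0 (k + 1)
    rw [zero_add, gaussBinom_self] at coord
    rw [show 2 * (k + 1) + 1 = 2 * k + 1 + 2 by ring, qHermite, map_sub, oddMoment_X_mul,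
      oddMoment_C_mul, ih, show 2 * k + 1 + 1 = 2 * (k + 1) by ring, coord,
      oddPochhammer_succ q (k + 1)]
    ring

theorem oddMoment_chebyshev_C (d : ℕ) :
    oddMoment q (Chebyshev.C R (2 * d + 1)) =
      alternatingTheta q (d + 1) - alternatingTheta q d := by
  refine eq_of_sum_range_mul_eq (a := fun k d => gaussBinom q (2 * k + 1) (k - d))
    (u := fun d => oddMoment q (Chebyshev.C R (2 * d + 1)))
    (v := fun d => alternatingTheta q (d + 1) - alternatingTheta q d) (fun k => ?_) (fun k => ?_) d
  · rw [Nat.sub_self, gaussBinom_zero_right]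
  · rw [sum_gaussBinom_mul_alternatingTheta_sub, ← oddMoment_qHermite,
      qHermite_two_mul_add_one_eq_sum, map_sum]
    exact sum_congr rfl fun d _ => (oddMoment_C_mul q _ _).symm

theorem one_sub_mul_jacobiCoord_X_pow (n : ℕ) :
    (1 - q) * jacobiCoord (tangentWeight q) (X ^ (2 * n)) 0 =
      ∑ d ∈ range (n + 1), ((2 * n + 1).choose (n - d) : R) *
        (alternatingTheta q (d + 1) - alternatingTheta q d) := by
  rw [← oddMoment_X_mul, ← pow_succ', ← qHermite_one, qHermite_two_mul_add_one_eq_sum, map_sum]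
  exact sum_congr rfl fun d _ => by
    rw [oddMoment_C_mul, oddMoment_chebyshev_C, gaussBinom_one]

end Moments

theorem theorem3 {K : Type*} [Field K] (q : K) (hq : q ≠ 1) (n : ℕ) :
    qTangentNumber q n =
      1 / (1 - q) ^ (2 * n + 1) *
        ∑ k ∈ Finset.range (n + 1),
          ((binomInt (2 * n + 1) ((n : ℤ) - k) - binomInt (2 * n + 1) ((n : ℤ) - k - 1) : ℤ) : K) *
            ∑ i ∈ Finset.range (2 * k + 2),
              (-1 : K) ^ (i + k) * q ^ (i * (2 * k + 2 - i)) := by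
  have h1q : 1 - q ≠ 0 := sub_ne_zero.mpr hq.symm
  have moment := one_sub_mul_jacobiCoord_X_pow q n
  rw [sum_choose_mul_sub _ _ (alternatingTheta_zero q)] at moment
  simp only [alternatingTheta_succ_eq_sum] at moment
  rw [qTangentNumber_eq, ← moment, pow_succ (1 - q) (2 * n), pow_mul (1 - q), div_pow, one_pow]
  field_simp
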